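/- Let $G$ be a finite group and let $\pi: G\to U(V)$ be a unitary representation of $G$ on a nonzero finite-dimensional complex Hilbert space $V$. In symmetric oracle discrimination, an element $a\in G$ is chosen uniformly at random and has to be identified by means of queries to the oracle $\pi(a)$. A $t$-query algorithm consists of an integer $N$, a unit vector $\psi\in V\otimes\mathbb{C}^N$, unitary operators $U_1,\dots,U_t$ on $V\otimes\mathbb{C}^N$, and a POVM $(E_x)_{x\in G}$ on $V\otimes\mathbb{C}^N$ (positive operators with sum $I$). Its final state for the hidden element $a$ is $$\psi_a = U_t(\pi(a)\otimes I)\,U_{t-1}(\pi(a)\otimes I)\cdots U_1(\pi(a)\otimes I)\,\psi ,$$ and its success probability is $\frac{1}{|G|}\sum_{a\in G}\langle\psi_a, E_a\psi_a\rangle$. For a finite-dimensional complex representation $W$ of $G$ with character $\chi_W$, let $I(W)$ be the set of irreducible complex characters $\chi$ of $G$ that appear in $W$, i.e. with $(\chi,\chi_W)>0$ for the usual inner product of characters. Then for every integer $t\ge 0$ the maximum of the success probability over all $t$-query algorithms is attained and equals $$P_{\rm opt} = \frac{1}{|G|}\sum_{\chi\in I(V^{\otimes t})}\chi(e)^2 .$$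 Consequently the exact query complexity of the problem, i.e. the least $t$ for which some $t$-query algorithm has success probability $1$ ($\infty$ if there is none), equals the quantum base size $\gamma(V)$, i.e. the least $t\ge 0$ such that every irreducible character of $G$ appears in $V^{\otimes t}$ ($\infty$ if there is none). -/

import Mathlib

open scoped TensorProduct InnerProductSpace ComplexOrder

noncomputable section

namespace SymmetricOracle

section Characters

variable {G : Type*} [Group G] [Fintype G]

/-- The usual inner product of class functions, `(χ, ψ) = |G|⁻¹ ∑ g, χ g * conj (ψ g)`. -/
def charInner (χ ψ : G → ℂ) : ℂ :=
  (Fintype.card G : ℂ)⁻¹ * ∑ g : G, χ g * starRingEnd ℂ (ψ g)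

/-- `Irr(G)`: the set of characters of irreducible complex representations of the finite group `G`.
Up to isomorphism such a representation lives on some `ℂⁿ`. -/
def irrChars (G : Type*) [Group G] : Set (G → ℂ) :=
  {χ | ∃ (n : ℕ) (ρ : Representation ℂ G (Fin n → ℂ)), ρ.IsIrreducible ∧ ρ.character = χ}

theorem irrChars_linearIndependent (G : Type*) [Group G] [Fintype G] :
    LinearIndependent ℂ (fun χ : irrChars G => (χ : G → ℂ)) := by
  classical
  have : Invertible (Nat.card G : ℂ) := invertibleOfNonzero (by simp)
  have ortho : ∀ χ ψ : irrChars G,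
      (Nat.card G : ℂ)⁻¹ * ∑ g : G, (χ : G → ℂ) g * (ψ : G → ℂ) g⁻¹ = if χ = ψ then 1 else 0 := by
    rintro ⟨_, n, ρ, hρ, rfl⟩ ⟨_, m, σ, hσ, rfl⟩
    rw [Representation.char_orthonormal ρ σ]
    by_cases h : Nonempty (Representation.Equiv σ ρ)
    · have e := Representation.char_iso h.some
      simp [h, e]
    · have hne : ρ.character ≠ σ.character := by
        intro e
        have h1 := Representation.char_orthonormal ρ σ
        have h2 := Representation.char_orthonormal ρ ρ
        have hr : Nonempty (Representation.Equiv ρ ρ) := ⟨Representation.Equiv.refl ρ⟩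
        rw [← e, h2] at h1
        simp [h, hr] at h1
      rw [if_neg h, if_neg fun he => hne (congrArg Subtype.val he)]
  rw [linearIndependent_iff']
  intro s c hc ψ hψ
  have h : (Nat.card G : ℂ)⁻¹ *
      ∑ g : G, (∑ χ ∈ s, c χ • (χ : G → ℂ)) g * (ψ : G → ℂ) g⁻¹ = c ψ := by
    calc _ = ∑ χ ∈ s, c χ *
          ((Nat.card G : ℂ)⁻¹ * ∑ g : G, (χ : G → ℂ) g * (ψ : G → ℂ) g⁻¹) := by
          simp only [Finset.sum_apply, Pi.smul_apply, smul_eq_mul, Finset.sum_mul, Finset.mul_sum]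
          rw [Finset.sum_comm]
          refine Finset.sum_congr rfl fun χ _ => Finset.sum_congr rfl fun g _ => by ring
      _ = c ψ := by
          simp only [ortho]
          simp [hψ]
  rw [← h, hc]
  simp

theorem irrChars_finite (G : Type*) [Group G] [Fintype G] : (irrChars G).Finite :=
  (irrChars_linearIndependent G).setFinite

variable {W : Type*} [AddCommGroup W] [Module ℂ W]

/-- `I(W)`: the set of irreducible characters `χ` appearing in the representation `W`, that is,
with `(χ, χ_W) > 0`. -/
def appearing (ρ : Representation ℂ G W) : Set (G → ℂ) :=
  {χ ∈ irrChars G | 0 < charInner χ ρ.character}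

theorem appearing_finite (ρ : Representation ℂ G W) : (appearing ρ).Finite :=
  (irrChars_finite G).subset fun _ h => h.1

/-- `d_W = ∑_{χ ∈ I(W)} χ(e)²`. -/
def sumSqDegrees (ρ : Representation ℂ G W) : ℂ :=
  ∑ χ ∈ (appearing_finite ρ).toFinset, χ 1 ^ 2

/-- The tensor power representation on `W^{⊗t}`, with `g` acting as `ρ(g) ⊗ ⋯ ⊗ ρ(g)`. -/
def tensorPow (ρ : Representation ℂ G W) (t : ℕ) :
    Representation ℂ G (⨂[ℂ] _ : Fin t, W) where
  toFun g := PiTensorProduct.map fun _ => ρ g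
  map_one' := by
    simp only [map_one]
    exact PiTensorProduct.map_one
  map_mul' g h := by
    simp only [map_mul]
    exact PiTensorProduct.map_mul _ _

/-- The quantum base size `γ(W)`: the least `t` such that every irreducible character of `G`
appears in `W^{⊗t}`, and `∞` if there is no such `t`. -/
def quantumBaseSize (ρ : Representation ℂ G W) : ℕ∞ :=
  sInf {T : ℕ∞ | ∃ t : ℕ, T = t ∧ irrChars G ⊆ appearing (tensorPow ρ t)}

end Characters

section Oracles

variable {G : Type*} [Group G] {V : Type*} [NormedAddCommGroup V] [InnerProductSpace ℂ V]

/-- The linear representation underlying a unitary representation `π : G → U(V)`. -/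
def toRep (π : G →* (V ≃ₗᵢ[ℂ] V)) : Representation ℂ G V where
  toFun g := (π g).toLinearEquiv.toLinearMap
  map_one' := by rw [map_one]; rfl
  map_mul' g h := by rw [map_mul]; rfl

/-- A `t`-query (adaptive) quantum algorithm, with queries to unitaries of `V`, whose output is an
element of `X`: the dimension `N` of the workspace, a unit vector `ψ` of `V ⊗ ℂᴺ`, unitaries
`U 0, …, U (t-1)` of `V ⊗ ℂᴺ` and a POVM `(E x)` indexed by `X`. -/
structure QueryAlgorithm (V : Type*) [NormedAddCommGroup V] [InnerProductSpace ℂ V]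
    (X : Type*) [Fintype X] (t : ℕ) where
  N : ℕ
  ψ : V ⊗[ℂ] EuclideanSpace ℂ (Fin N)
  norm_ψ : ‖ψ‖ = 1
  U : Fin t → ((V ⊗[ℂ] EuclideanSpace ℂ (Fin N)) ≃ₗᵢ[ℂ] (V ⊗[ℂ] EuclideanSpace ℂ (Fin N)))
  E : X → ((V ⊗[ℂ] EuclideanSpace ℂ (Fin N)) →ₗ[ℂ] (V ⊗[ℂ] EuclideanSpace ℂ (Fin N)))
  E_pos : ∀ x, (E x).IsPositive
  E_sum : ∑ x, E x = LinearMap.id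

namespace QueryAlgorithm

variable {X : Type*} [Fintype X] {t : ℕ}

/-- The final state `U_t (O ⊗ I) ⋯ U_1 (O ⊗ I) ψ` of the algorithm when the oracle is `O`. -/
def finalState (A : QueryAlgorithm V X t) (O : V ≃ₗᵢ[ℂ] V) :
    V ⊗[ℂ] EuclideanSpace ℂ (Fin A.N) :=
  Fin.foldl t
    (fun φ i => A.U i (O.toLinearEquiv.toLinearMap.rTensor (EuclideanSpace ℂ (Fin A.N)) φ)) A.ψ

/-- The probability `⟨ψ_O, E_x ψ_O⟩` that the algorithm outputs `x` when the oracle is `O`. -/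
def outputProb (A : QueryAlgorithm V X t) (O : V ≃ₗᵢ[ℂ] V) (x : X) : ℝ :=
  (⟪A.finalState O, A.E x (A.finalState O)⟫_ℂ).re

end QueryAlgorithm

variable [Fintype G]

/-- The success probability of an algorithm for symmetric oracle discrimination: the probability
of outputting `a` with the oracle `π a`, for `a` uniformly distributed in `G`. -/
def successProb (π : G →* (V ≃ₗᵢ[ℂ] V)) {t : ℕ} (A : QueryAlgorithm V G t) : ℝ :=
  (Fintype.card G : ℝ)⁻¹ * ∑ a : G, A.outputProb (π a) a

/-- The exact quantum query complexity of symmetric oracle discrimination: the least number `t` of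
queries for which some `t`-query algorithm succeeds with probability `1`, and `∞` if there is no
such `t`. -/
def exactQueryComplexity (π : G →* (V ≃ₗᵢ[ℂ] V)) : ℕ∞ :=
  sInf {T : ℕ∞ | ∃ t : ℕ, T = t ∧ ∃ A : QueryAlgorithm V G t, successProb π A = 1}

end Oracles

end SymmetricOracle

end

/-! Everything is governed by one integer, D = dim span {π(g)^{⊗t}} (`tensorPowDim`): the optimum is
D/|G|.

Upper bound. Expanding every query in matrix units shows that the final state is a fixed linear
image of π(a)^{⊗t} (`exists_foldl_eq_sum`), so the |G| final states span a space K of dimension at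
most D. For a unit vector ψ_a in K, ⟨ψ_a, E_a ψ_a⟩ is at most the trace of E_a compressed to K;
summing over a gives dim K, because the E_a sum to the identity (`sum_re_inner_le_finrank`).

Attainment. Queries interleaved with changes of tensor factor implement π(a)^{⊗t} ⊗ 1
(`finalState_eq_powRep`). Under this representation the orbit of a maximally entangled vector spans
dimension at least D. Applying the inverse square root of its frame operator, which commutes with G,
gives an orbit that is a Parseval frame of its span (`exists_bessel_orbit`). Its rank-one operators,
completed to a POVM, identify the normalised orbit with probability at least D/|G|.

Finally D is the dimension of the image of the group algebra in End(V^{⊗t}). An element of the group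
algebra acts as zero there iff it does so in every irreducible constituent, and the group algebra
maps onto the product of the matrix algebras of inequivalent irreducibles, so D is the sum of χ(e)²
over the constituents (`finrank_span_range_eq_sumSqDegrees`). For the regular representation this
sum is |G|, whence D = |G| exactly when no irreducible character is missing. -/

noncomputable section

namespace SymmetricOracle

/-! ### Image of the group algebra in a representation, and squared degrees. -/

section RepresentationTheory

variable {G : Type*} [Group G] [Fintype G]
variable {W : Type*} [AddCommGroup W] [Module ℂ W]

/-- The operator `∑ g, c g • ρ g` as a linear function of the coefficients `c`. -/
def groupSum (ρ : Representation ℂ G W) : (G → ℂ) →ₗ[ℂ] Module.End ℂ W :=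
  Fintype.linearCombination ℂ fun g => ρ g

theorem groupSum_apply (ρ : Representation ℂ G W) (c : G → ℂ) (w : W) :
    groupSum ρ c w = ∑ g, c g • ρ g w := by
  simp [groupSum, Fintype.linearCombination_apply]

theorem range_groupSum (ρ : Representation ℂ G W) :
    LinearMap.range (groupSum ρ) = Submodule.span ℂ (Set.range fun g => ρ g) :=
  Fintype.range_linearCombination ℂ _

theorem intertwining_groupSum {W' : Type*} [AddCommGroup W'] [Module ℂ W']
    {ρ : Representation ℂ G W} {σ : Representation ℂ G W'}
    (f : Representation.IntertwiningMap ρ σ) (c : G → ℂ) (w : W) :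
    f (groupSum ρ c w) = groupSum σ c (f w) := by
  simp [groupSum_apply, map_sum, map_smul, f.isIntertwining]

omit [Fintype G] in
/-- A finite-dimensional representation is equivalent to a matrix representation. -/
theorem exists_equiv_fin [FiniteDimensional ℂ W] (ρ : Representation ℂ G W) :
    ∃ σ : Representation ℂ G (Fin (Module.finrank ℂ W) → ℂ),
      Nonempty (Representation.Equiv ρ σ) := by
  let e : W ≃ₗ[ℂ] (Fin (Module.finrank ℂ W) → ℂ) := (Module.finBasis ℂ W).equivFun
  let σ : Representation ℂ G (Fin (Module.finrank ℂ W) → ℂ) :=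
    { toFun := fun g => e.toLinearMap ∘ₗ ρ g ∘ₗ e.symm.toLinearMap
      map_one' := by ext; simp
      map_mul' := fun g h => by ext; simp }
  exact ⟨σ, ⟨Representation.Equiv.mk e fun g => by ext w; simp [σ]⟩⟩

-- The average B of the matrices (M g)ᴴ * M g is, up to a factor, the Gram matrix of an invariant
-- inner product. It conjugates M h into (M h⁻¹)ᴴ, and similar matrices have equal trace. This turns
-- the conjugation in `charInner` into the inversion used in the orthogonality relations.
open Matrix in
theorem character_inv [FiniteDimensional ℂ W] (ρ : Representation ℂ G W) (h : G) :
    ρ.character h⁻¹ = starRingEnd ℂ (ρ.character h) := by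
  classical
  let b := Module.finBasis ℂ W
  let M : G → Matrix _ _ ℂ := fun g => LinearMap.toMatrix b b (ρ g)
  have hM : ∀ g k, M (g * k) = M g * M k := fun g k => by
    simp only [M, map_mul, LinearMap.toMatrix_mul]
  have hM1 : M 1 = 1 := by simp only [M, map_one, LinearMap.toMatrix_one]
  let B := ∑ g, (M g)ᴴ * M g
  have hB : B.PosDef := by
    refine Matrix.posDef_sum (Finset.univ_nonempty) fun g _ => ?_
    refine Matrix.PosDef.conjTranspose_mul_self _ ?_
    refine Matrix.mulVec_injective_of_isUnit ?_
    exact IsUnit.of_mul_eq_one (M g⁻¹) (by rw [← hM, mul_inv_cancel, hM1])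
  have hBdet : IsUnit B.det := (Matrix.isUnit_iff_isUnit_det B).1 hB.isUnit
  have key : B * M h = (M h⁻¹)ᴴ * B := by
    simp only [B, Finset.sum_mul, Finset.mul_sum]
    rw [← Equiv.sum_comp (Equiv.mulRight h⁻¹)]
    refine Finset.sum_congr rfl fun g _ => ?_
    simp only [Equiv.coe_mulRight]
    rw [Matrix.mul_assoc, ← hM, inv_mul_cancel_right, hM, Matrix.conjTranspose_mul,
      Matrix.mul_assoc]
  have htr : ∀ g, ρ.character g = (M g).trace := fun g => by
    simp only [Representation.character, M]
    exact LinearMap.trace_eq_matrix_trace ℂ b _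
  have h2 : (M h⁻¹)ᴴ = B * M h * B⁻¹ := by
    rw [key, Matrix.mul_assoc, Matrix.mul_nonsing_inv _ hBdet, Matrix.mul_one]
  have h3 : starRingEnd ℂ (M h⁻¹).trace = (M h).trace := by
    have := Matrix.trace_conjTranspose (M h⁻¹)
    rw [h2, Matrix.trace_mul_cycle, Matrix.nonsing_inv_mul _ hBdet, Matrix.one_mul] at this
    rw [this]; rfl
  rw [htr, htr, ← h3, Complex.conj_conj]

theorem charInner_eq_finrank [FiniteDimensional ℂ W] {W' : Type*} [AddCommGroup W'] [Module ℂ W']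
    [FiniteDimensional ℂ W'] (ρ : Representation ℂ G W) (σ : Representation ℂ G W') :
    charInner σ.character ρ.character =
      (Module.finrank ℂ (Representation.IntertwiningMap σ ρ) : ℂ) := by
  have : Invertible (Nat.card G : ℂ) := invertibleOfNonzero (by simp)
  rw [← Representation.card_inv_mul_sum_char_mul_char_eq_finrank, charInner, Nat.card_eq_fintype_card,
    ← Equiv.sum_comp (Equiv.inv G)]
  congr 1
  refine Finset.sum_congr rfl fun g _ => ?_
  rw [Equiv.inv_apply, character_inv ρ g, Complex.conj_conj, mul_comm]

theorem charInner_pos_iff [FiniteDimensional ℂ W] {W' : Type*} [AddCommGroup W'] [Module ℂ W']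
    [FiniteDimensional ℂ W'] (ρ : Representation ℂ G W) (σ : Representation ℂ G W') :
    0 < charInner σ.character ρ.character ↔
      ∃ f : Representation.IntertwiningMap σ ρ, f ≠ 0 := by
  rw [charInner_eq_finrank, Nat.cast_pos, Module.finrank_pos_iff_exists_ne_zero]

/-- An element of the group algebra that vanishes in all irreducible representations embedded in
`σ` vanishes in `σ`. -/
theorem groupSum_eq_zero_of_irreducible (c : G → ℂ) (n : ℕ) :
    ∀ σ : Representation ℂ G (Fin n → ℂ),
      (∀ (m : ℕ) (τ : Representation ℂ G (Fin m → ℂ)), τ.IsIrreducible →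
        (∃ f : Representation.IntertwiningMap τ σ, f ≠ 0) → groupSum τ c = 0) →
      groupSum σ c = 0 := by
  induction n using Nat.strong_induction_on with
  | _ n ih =>
  intro σ hσ
  have hss : Representation.IsSemisimpleRepresentation σ := inferInstance
  by_cases hn : n = 0
  · subst hn
    exact Subsingleton.elim _ _
  have : Nonempty (Fin n) := ⟨⟨0, Nat.pos_of_ne_zero hn⟩⟩
  by_cases hirr : σ.IsIrreducible
  · refine hσ n σ hirr ⟨Representation.IntertwiningMap.id σ, fun h => ?_⟩
    have := DFunLike.congr_fun h (fun _ => (1 : ℂ))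
    have := congrFun this (Classical.arbitrary _)
    simp at this
  -- A proper subrepresentation has smaller dimension, and an irreducible embedded in it is also
  -- embedded in σ, so the induction hypothesis applies to it.
  have hsub : ∀ S : Subrepresentation σ, S ≠ ⊤ →
      ∀ w ∈ S, groupSum σ c w = 0 := by
    intro S hS w hw
    obtain ⟨τ, ⟨e⟩⟩ := exists_equiv_fin S.toRepresentation
    let ι : Representation.IntertwiningMap S.toRepresentation σ :=
      ⟨S.toSubmodule.subtype, fun g => by ext; rfl⟩
    have hlt : Module.finrank ℂ S.toSubmodule < n := by
      have : S.toSubmodule < ⊤ := by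
        refine lt_top_iff_ne_top.2 fun h => hS ?_
        exact Subrepresentation.toSubmodule_injective h
      simpa using Submodule.finrank_lt this.ne
    have h0 := ih _ hlt τ fun m τ' hτ' ⟨f, hf⟩ => by
      refine hσ m τ' hτ' ⟨ι.comp (e.symm.toIntertwiningMap.comp f), fun h => hf ?_⟩
      refine Representation.IntertwiningMap.ext (LinearMap.ext fun x => ?_)
      have h1 : ι (e.symm (f x)) = 0 := DFunLike.congr_fun h x
      have h2 : e.symm (f x) = 0 := Subtype.ext h1
      have h3 := congrArg e h2
      rw [Representation.Equiv.apply_symm_apply, map_zero] at h3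
      exact h3
    have h1 : groupSum S.toRepresentation c = 0 := by
      ext1 x
      have := intertwining_groupSum e.symm.toIntertwiningMap c (e x)
      simpa [h0] using this.symm
    have := intertwining_groupSum ι c ⟨w, hw⟩
    rw [h1] at this
    simpa [ι] using this.symm
  have hex : ∃ S : Subrepresentation σ, S ≠ ⊥ ∧ S ≠ ⊤ := by
    by_contra! h
    refine hirr ?_
    have : Nontrivial (Subrepresentation σ) := by
      refine ⟨⊥, ⊤, fun h => ?_⟩
      have := congrArg Subrepresentation.toSubmodule h
      exact bot_ne_top (α := Submodule ℂ (Fin n → ℂ)) this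
    exact ⟨fun S => or_iff_not_imp_left.2 (h S)⟩
  obtain ⟨S, hS0, hS1⟩ := hex
  -- By Maschke σ is the sum of two proper subrepresentations, and the group sum vanishes on both.
  obtain ⟨S', hS'⟩ := exists_isCompl S
  have hS'1 : S' ≠ ⊤ := fun h => by
    subst h
    exact hS0 (by simpa using hS'.inf_eq_bot)
  refine LinearMap.ext fun w => ?_
  have hw : w ∈ S.toSubmodule ⊔ S'.toSubmodule := by
    rw [← Subrepresentation.toSubmodule_sup, hS'.sup_eq_top]
    trivial
  obtain ⟨x, hx, y, hy, rfl⟩ := Submodule.mem_sup.1 hw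
  simp [hsub S hS1 x hx, hsub S' hS'1 y hy]

/-- Averaging the rank-one map u ↦ l(u) v over conjugation by G makes it equivariant. Read with u
fixed and v variable, the same sum is a group sum whose coefficients are matrix coefficients of τ;
this is how Schur's lemma yields the orthogonality relations. -/
theorem exists_intertwining_average {W' : Type*} [AddCommGroup W'] [Module ℂ W']
    (τ : Representation ℂ G W) (τ' : Representation ℂ G W') (l : W →ₗ[ℂ] ℂ) (v : W') :
    ∃ A : Representation.IntertwiningMap τ τ',
      A.toLinearMap = ∑ g, (l ∘ₗ τ g⁻¹).smulRight (τ' g v) := by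
  refine ⟨⟨∑ g, (l ∘ₗ τ g⁻¹).smulRight (τ' g v), fun h => ?_⟩, rfl⟩
  ext1 u
  simp only [LinearMap.comp_apply, LinearMap.sum_apply, LinearMap.smulRight_apply, map_sum,
    map_smul]
  rw [← Equiv.sum_comp (Equiv.mulLeft h)]
  refine Finset.sum_congr rfl fun g _ => ?_
  rw [Equiv.coe_mulLeft, mul_inv_rev, ← Module.End.mul_apply, ← map_mul, inv_mul_cancel_right,
    map_mul, Module.End.mul_apply]

/-- Schur orthogonality of the matrix coefficients of inequivalent irreducible representations. -/
theorem groupSum_coeff_of_not_equiv {W' : Type*} [AddCommGroup W'] [Module ℂ W']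
    (τ : Representation ℂ G W) (τ' : Representation ℂ G W') [τ.IsIrreducible] [τ'.IsIrreducible]
    (h : IsEmpty (Representation.Equiv τ τ')) (l : W →ₗ[ℂ] ℂ) (u : W) :
    groupSum τ' (fun g => l (τ g⁻¹ u)) = 0 := by
  ext1 v
  obtain ⟨A, hA⟩ := exists_intertwining_average τ τ' l v
  have h0 : A = 0 := Subsingleton.elim _ _
  have := congrArg (fun B => B u) hA
  rw [h0] at this
  simpa [groupSum_apply] using this.symm

/-- Schur orthogonality of the matrix coefficients of an irreducible representation. -/
theorem groupSum_coeff_self [FiniteDimensional ℂ W] (τ : Representation ℂ G W) [τ.IsIrreducible]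
    (l : W →ₗ[ℂ] ℂ) (u : W) :
    (Module.finrank ℂ W : ℂ) • groupSum τ (fun g => l (τ g⁻¹ u)) =
      (Fintype.card G : ℂ) • l.smulRight u := by
  ext1 v
  obtain ⟨A, hA⟩ := exists_intertwining_average τ τ l v
  obtain ⟨z, hz⟩ :=
    (Representation.IsIrreducible.algebraMap_intertwiningMap_bijective_of_isAlgClosed
      (ρ := τ)).2 A
  have hA' : A.toLinearMap = z • LinearMap.id := by rw [← hz]; rfl
  -- The scalar z given by Schur's lemma is found by taking traces: each of the |G| conjugates of
  -- the rank-one map has trace l(v).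
  have htr : z * Module.finrank ℂ W = Fintype.card G * l v := by
    have := congrArg (LinearMap.trace ℂ W) (hA'.symm.trans hA)
    rw [map_smul, LinearMap.trace_id, map_sum] at this
    simp only [LinearMap.trace_smulRight, LinearMap.comp_apply] at this
    simp only [← Module.End.mul_apply, ← map_mul, inv_mul_cancel, map_one,
      Module.End.one_apply] at this
    simpa using this
  have hu := congrArg (fun B => B u) (hA'.symm.trans hA)
  simp only [LinearMap.smul_apply, LinearMap.id_apply, LinearMap.sum_apply,
    LinearMap.smulRight_apply, LinearMap.comp_apply] at hu
  rw [LinearMap.smul_apply, LinearMap.smul_apply, groupSum_apply, ← hu, LinearMap.smulRight_apply,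
    smul_smul, smul_smul, ← htr, mul_comm]

/-- Every endomorphism is a sum of rank-one maps, and Schur orthogonality exhibits each rank-one map
in block i as the image of a matrix coefficient of `τ i`, which vanishes in all the other blocks. -/
theorem groupSum_pi_surjective {ι : Type*} [Fintype ι] (n : ι → ℕ)
    (τ : ∀ i, Representation ℂ G (Fin (n i) → ℂ)) (hτ : ∀ i, (τ i).IsIrreducible)
    (hne : ∀ i j, i ≠ j → IsEmpty (Representation.Equiv (τ i) (τ j))) :
    LinearMap.range (LinearMap.pi fun i => groupSum (τ i)) = ⊤ := by
  classical
  rw [eq_top_iff]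
  rintro X -
  rw [← Finset.univ_sum_single X]
  refine Submodule.sum_mem _ fun i _ => ?_
  have hn : (n i : ℂ) ≠ 0 := by
    intro h
    have h0 : n i = 0 := by exact_mod_cast h
    have : Subsingleton (Fin (n i) → ℂ) := by rw [h0]; infer_instance
    have := (hτ i).toNontrivial
    obtain ⟨a, b, hab⟩ := this
    exact hab (Subrepresentation.toSubmodule_injective (Subsingleton.elim _ _))
  have hX : X i = ∑ j, ((LinearMap.proj j : (Fin (n i) → ℂ) →ₗ[ℂ] ℂ).smulRight
      (X i (Pi.single j 1))) := by
    refine LinearMap.pi_ext' fun j => ?_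
    ext1
    simp [Pi.single_apply]
  rw [hX]
  have : Pi.single i (∑ j, ((LinearMap.proj j : (Fin (n i) → ℂ) →ₗ[ℂ] ℂ).smulRight
      (X i (Pi.single j 1)))) = ∑ j, LinearMap.single ℂ (fun i => Module.End ℂ (Fin (n i) → ℂ)) i
        ((LinearMap.proj j : (Fin (n i) → ℂ) →ₗ[ℂ] ℂ).smulRight (X i (Pi.single j 1))) := by
    rw [← map_sum]; rfl
  rw [this]
  refine Submodule.sum_mem _ fun j _ => ?_
  -- The factor n i / |G| cancels the constants in `groupSum_coeff_self`.
  refine ⟨((n i : ℂ) / Fintype.card G) • fun g => (LinearMap.proj j : (Fin (n i) → ℂ) →ₗ[ℂ] ℂ)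
    (τ i g⁻¹ (X i (Pi.single j 1))), ?_⟩
  funext k
  rw [LinearMap.pi_apply, map_smul]
  by_cases hk : i = k
  · subst hk
    have := groupSum_coeff_self (τ i) (LinearMap.proj j) (X i (Pi.single j 1))
    rw [Module.finrank_fin_fun] at this
    have hc : (Fintype.card G : ℂ) ≠ 0 := by simp
    rw [div_eq_inv_mul, ← smul_smul, this, smul_smul, inv_mul_cancel₀ hc, one_smul]
    simp
  · have := hτ i
    have := hτ k
    rw [groupSum_coeff_of_not_equiv (τ i) (τ k) (hne i k hk)]
    simp [Ne.symm hk]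

/-- The dimension of the span of the operators of a representation is the sum of the squared
degrees of the irreducible characters appearing in it. -/
theorem finrank_span_range_eq_sumSqDegrees [FiniteDimensional ℂ W] (ρ : Representation ℂ G W) :
    (Module.finrank ℂ (Submodule.span ℂ (Set.range fun g => ρ g)) : ℂ) = sumSqDegrees ρ := by
  classical
  have : Fintype (appearing ρ) := (appearing_finite ρ).fintype
  choose n τ hτ hχ using fun χ : appearing ρ => χ.2.1
  have hne : ∀ i j, i ≠ j → IsEmpty (Representation.Equiv (τ i) (τ j)) := by
    refine fun i j hij => ⟨fun e => hij (Subtype.ext ?_)⟩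
    rw [← hχ i, ← hχ j, Representation.char_iso e]
  have hsurj := groupSum_pi_surjective n τ hτ hne
  have hker : LinearMap.ker (groupSum ρ) = LinearMap.ker (LinearMap.pi fun i => groupSum (τ i)) := by
    ext c
    rw [LinearMap.mem_ker, LinearMap.mem_ker]
    constructor
    · intro hc
      funext i
      have h1 := i.2.2
      rw [← hχ i, charInner_pos_iff] at h1
      obtain ⟨f, hf⟩ := h1
      have := hτ i
      -- An appearing irreducible embeds in ρ, so whatever vanishes in ρ vanishes in it.
      have hinj := (Representation.IsIrreducible.injective_or_eq_zero f).resolve_right hf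
      refine LinearMap.ext fun v => hinj ?_
      have := intertwining_groupSum f c v
      rw [hc] at this
      simpa using this
    · intro hc
      obtain ⟨σ, ⟨e⟩⟩ := exists_equiv_fin ρ
      have hσ : groupSum σ c = 0 := by
        refine groupSum_eq_zero_of_irreducible c _ σ fun m τ' hτ' hf => ?_
        have hmem : τ'.character ∈ appearing ρ := by
          refine ⟨⟨m, τ', hτ', rfl⟩, ?_⟩
          rw [Representation.char_iso e, charInner_pos_iff]
          exact hf
        have h1 : groupSum (τ ⟨_, hmem⟩) c = 0 := congrFun hc ⟨_, hmem⟩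
        -- The representative chosen for the character of τ' is equivalent to τ'; otherwise
        -- orthogonality would make the norm of that character both 0 and 1.
        have hE : Nonempty (Representation.Equiv (τ ⟨_, hmem⟩) τ') := by
          by_contra h
          have := hτ ⟨_, hmem⟩
          have : Invertible (Nat.card G : ℂ) := invertibleOfNonzero (by simp)
          have h2 := Representation.char_orthonormal τ' (τ ⟨_, hmem⟩)
          have h3 := Representation.char_orthonormal τ' τ'
          rw [if_neg h, hχ ⟨_, hmem⟩] at h2
          rw [if_pos ⟨Representation.Equiv.refl _⟩, h2] at h3
          exact zero_ne_one h3
        obtain ⟨e'⟩ := hE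
        refine LinearMap.ext fun x => ?_
        have := intertwining_groupSum e'.toIntertwiningMap c (e'.symm x)
        rw [h1] at this
        simpa using this.symm
      ext1 x
      have := intertwining_groupSum e.symm.toIntertwiningMap c (e x)
      simpa [hσ] using this.symm
  -- Two linear maps on ℂ^G with the same kernel have the same rank.
  have hrank : Module.finrank ℂ (LinearMap.range (groupSum ρ)) =
      Module.finrank ℂ (LinearMap.range (LinearMap.pi fun i => groupSum (τ i))) := by
    have h1 := LinearMap.finrank_range_add_finrank_ker (groupSum ρ)
    have h2 := LinearMap.finrank_range_add_finrank_ker (LinearMap.pi fun i => groupSum (τ i))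
    rw [hker] at h1
    omega
  rw [← range_groupSum, hrank, hsurj, finrank_top, Module.finrank_pi_fintype, sumSqDegrees,
    ← Finset.sum_coe_sort (appearing_finite ρ).toFinset, Nat.cast_sum]
  let eq : (appearing_finite ρ).toFinset ≃ appearing ρ :=
    Equiv.subtypeEquivRight fun χ => (appearing_finite ρ).mem_toFinset
  rw [← Equiv.sum_comp eq]
  refine Finset.sum_congr rfl fun χ _ => ?_
  have h1 : (χ : G → ℂ) 1 = n (eq χ) := by
    have := congrFun (hχ (eq χ)) 1
    rw [Representation.char_one, Module.finrank_fin_fun] at this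
    exact this.symm
  rw [h1, Module.finrank_linearMap, Module.finrank_fin_fun]
  push_cast
  ring

omit [Group G] in
theorem charInner_comm (χ ψ : G → ℂ) : charInner ψ χ = starRingEnd ℂ (charInner χ ψ) := by
  simp [charInner, map_sum, mul_comm]

/-- Hom_G(ℂ[G], τ) ≅ τ by evaluation at the identity, and τ is nonzero. Symmetry of the inner
product puts the regular representation on the source side. -/
theorem irrChars_subset_appearing_leftRegular :
    irrChars G ⊆ appearing (Representation.leftRegular ℂ G) := by
  rintro _ ⟨n, τ, hτ, rfl⟩
  refine ⟨⟨n, τ, hτ, rfl⟩, ?_⟩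
  rw [charInner_comm, charInner_eq_finrank, (Representation.leftRegularMapEquiv τ).finrank_eq,
    Complex.conj_natCast, Nat.cast_pos]
  obtain ⟨a, b, hab⟩ := hτ.toNontrivial
  rw [Module.finrank_pos_iff]
  by_contra h
  rw [not_nontrivial_iff_subsingleton] at h
  exact hab (Subrepresentation.toSubmodule_injective (Subsingleton.elim _ _))

/-- The operators send the basis vector of the identity to distinct basis vectors. -/
theorem linearIndependent_leftRegular :
    LinearIndependent ℂ fun g => Representation.leftRegular ℂ G g := by
  rw [Fintype.linearIndependent_iff]
  intro c hc g
  have := congrArg (fun A => (A (MonoidAlgebra.single 1 1)).coeff g) hc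
  simp only [LinearMap.sum_apply, LinearMap.smul_apply, Representation.ofMulAction_single,
    MonoidAlgebra.coeff_sum, MonoidAlgebra.coeff_smul, MonoidAlgebra.coeff_single,
    Finsupp.finsetSum_apply, Finsupp.smul_apply, LinearMap.zero_apply, MonoidAlgebra.coeff_zero,
    Finsupp.zero_apply, smul_eq_mul, mul_one] at this
  rw [Finset.sum_eq_single g, Finsupp.single_eq_same] at this
  · simpa using this
  · intro k _ hk
    rw [Finsupp.single_eq_of_ne hk.symm, mul_zero]
  · simp

variable (G) in
theorem sum_irrChars_sq :
    ∑ χ ∈ (irrChars_finite G).toFinset, χ 1 ^ 2 = (Fintype.card G : ℂ) := by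
  have h := finrank_span_range_eq_sumSqDegrees (Representation.leftRegular ℂ G)
  rw [finrank_span_eq_card linearIndependent_leftRegular, sumSqDegrees] at h
  rw [h]
  refine Finset.sum_congr (Finset.ext fun χ => ?_) fun _ _ => rfl
  rw [Set.Finite.mem_toFinset, Set.Finite.mem_toFinset]
  exact ⟨fun h => irrChars_subset_appearing_leftRegular h, fun h => h.1⟩

omit [Fintype G] in
theorem irrChars_apply_one_pos {χ : G → ℂ} (h : χ ∈ irrChars G) : 0 < χ 1 := by
  obtain ⟨n, τ, hτ, rfl⟩ := h
  rw [Representation.char_one, Nat.cast_pos]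
  obtain ⟨a, b, hab⟩ := hτ.toNontrivial
  rw [Module.finrank_pos_iff]
  by_contra h
  rw [not_nontrivial_iff_subsingleton] at h
  exact hab (Subrepresentation.toSubmodule_injective (Subsingleton.elim _ _))

/-- The squared degrees are positive and those of all irreducible characters add up to |G|, so
omitting any one of them makes the sum strictly smaller. -/
theorem sumSqDegrees_eq_card_iff (ρ : Representation ℂ G W) :
    sumSqDegrees ρ = (Fintype.card G : ℂ) ↔ irrChars G ⊆ appearing ρ := by
  have hsub : (appearing_finite ρ).toFinset ⊆ (irrChars_finite G).toFinset := fun χ hχ => by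
    rw [Set.Finite.mem_toFinset] at hχ ⊢
    exact hχ.1
  rw [← sum_irrChars_sq G, sumSqDegrees]
  constructor
  · intro h χ hχ
    by_contra hn
    refine (Finset.sum_lt_sum_of_subset hsub ((irrChars_finite G).mem_toFinset.2 hχ)
      (fun h => hn ((appearing_finite ρ).mem_toFinset.1 h))
      (f := fun χ : G → ℂ => χ 1 ^ 2) (pow_pos (irrChars_apply_one_pos hχ) 2) ?_).ne h
    intro ψ hψ _
    exact (pow_pos (irrChars_apply_one_pos ((irrChars_finite G).mem_toFinset.1 hψ)) 2).le
  · intro h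
    refine Finset.sum_congr (Finset.Subset.antisymm hsub fun χ hχ => ?_) fun _ _ => rfl
    rw [Set.Finite.mem_toFinset] at hχ ⊢
    exact h hχ

end RepresentationTheory

/-! ### Measurement bounds, POVMs and tight frames of orbits. -/

section Measurements

variable {H : Type*} [NormedAddCommGroup H] [InnerProductSpace ℂ H] [FiniteDimensional ℂ H]

/-- A pure state in a subspace `K` is measured with probability at most the trace of the
compression of the positive operator to `K`. -/
theorem re_inner_le_sum_basis (T : H →ₗ[ℂ] H) (hT : T.IsPositive) (K : Submodule ℂ H)
    {ι : Type*} [Fintype ι] (b : OrthonormalBasis ι ℂ K) (x : H) (hx : x ∈ K) (hx1 : ‖x‖ = 1) :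
    (⟪x, T x⟫_ℂ).re ≤ ∑ i, (⟪(b i : H), T (b i)⟫_ℂ).re := by
  have hT' : T.toContinuousLinearMap.IsPositive :=
    (LinearMap.isPositive_toContinuousLinearMap_iff T).2 hT
  obtain ⟨m, u, hu⟩ := ContinuousLinearMap.isPositive_iff_eq_sum_rankOne.1 hT'
  have hTu : ∀ y, (⟪y, T y⟫_ℂ).re = ∑ j, ‖⟪u j, y⟫_ℂ‖ ^ 2 := by
    intro y
    have h1 : T y = ∑ j, ⟪u j, y⟫_ℂ • u j := by
      have := congrArg (fun A => A y) hu
      simpa using this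
    rw [h1, inner_sum, Complex.re_sum]
    refine Finset.sum_congr rfl fun j _ => ?_
    rw [inner_smul_right, ← inner_conj_symm y, Complex.mul_conj, Complex.ofReal_re,
      Complex.normSq_eq_norm_sq]
  simp only [hTu]
  rw [Finset.sum_comm]
  refine Finset.sum_le_sum fun j _ => ?_
  -- For each rank-one term of T the claim is Cauchy–Schwarz for the projection of u j to K, whose
  -- square norm is then expanded by Parseval in the basis b.
  have hP : ∀ y : K, ⟪u j, (y : H)⟫_ℂ = ⟪K.orthogonalProjectionOnto (u j), y⟫_ℂ := fun y => by
    simp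
  have h1 := hP ⟨x, hx⟩
  simp only at h1
  rw [h1]
  calc ‖⟪K.orthogonalProjectionOnto (u j), (⟨x, hx⟩ : K)⟫_ℂ‖ ^ 2
      ≤ ‖K.orthogonalProjectionOnto (u j)‖ ^ 2 := by
        gcongr
        refine (norm_inner_le_norm _ _).trans ?_
        rw [show ‖(⟨x, hx⟩ : K)‖ = 1 from hx1, mul_one]
    _ = ∑ i, ‖⟪u j, (b i : H)⟫_ℂ‖ ^ 2 := by
        rw [← b.sum_sq_norm_inner_left]
        exact Finset.sum_congr rfl fun i _ => by rw [hP]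

/-- Each term is at most the trace of E x compressed to the span; these traces add up to the trace
of the identity of the span. -/
theorem sum_re_inner_le_finrank {X : Type*} [Fintype X] (E : X → H →ₗ[ℂ] H)
    (hE : ∀ x, (E x).IsPositive) (hsum : ∑ x, E x = LinearMap.id) (ψ : X → H)
    (hψ : ∀ x, ‖ψ x‖ = 1) :
    ∑ x, (⟪ψ x, E x (ψ x)⟫_ℂ).re ≤ Module.finrank ℂ (Submodule.span ℂ (Set.range ψ)) := by
  let b := stdOrthonormalBasis ℂ (Submodule.span ℂ (Set.range ψ))
  calc ∑ x, (⟪ψ x, E x (ψ x)⟫_ℂ).re ≤ ∑ x, ∑ i, (⟪(b i : H), E x (b i)⟫_ℂ).re :=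
        Finset.sum_le_sum fun x _ => re_inner_le_sum_basis (E x) (hE x) _ b (ψ x)
          (Submodule.subset_span ⟨x, rfl⟩) (hψ x)
    _ = ∑ i, (⟪(b i : H), (∑ x, E x) (b i)⟫_ℂ).re := by
        rw [Finset.sum_comm]
        refine Finset.sum_congr rfl fun i _ => ?_
        rw [LinearMap.sum_apply, inner_sum, Complex.re_sum]
    _ = Module.finrank ℂ (Submodule.span ℂ (Set.range ψ)) := by
        have : ∀ i, (⟪(b i : H), (b i : H)⟫_ℂ).re = 1 := fun i => by
          rw [← Submodule.coe_inner, b.inner_eq_one, Complex.one_re]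
        simp only [hsum, LinearMap.id_apply, this]
        simp

omit [FiniteDimensional ℂ H] in
theorem sum_rankOne_inner {X : Type*} [Fintype X] (w : X → H) (x : H) :
    ⟪x, ∑ a, ⟪w a, x⟫_ℂ • w a⟫_ℂ = ((∑ a, ‖⟪w a, x⟫_ℂ‖ ^ 2 : ℝ) : ℂ) := by
  rw [inner_sum, Complex.ofReal_sum]
  refine Finset.sum_congr rfl fun j _ => ?_
  rw [inner_smul_right, ← inner_conj_symm x, Complex.mul_conj, Complex.normSq_eq_norm_sq]

omit [FiniteDimensional ℂ H] in
/-- A Bessel family of vectors extends to a POVM. -/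
theorem exists_povm {X : Type*} [Fintype X] [Nonempty X] (w : X → H)
    (hw : ∀ x, ∑ a, ‖⟪w a, x⟫_ℂ‖ ^ 2 ≤ ‖x‖ ^ 2) :
    ∃ E : X → H →ₗ[ℂ] H, (∀ a, (E a).IsPositive) ∧ ∑ a, E a = LinearMap.id ∧
      ∀ a x, ‖⟪w a, x⟫_ℂ‖ ^ 2 ≤ (⟪x, E a x⟫_ℂ).re := by
  classical
  let r : X → H →ₗ[ℂ] H := fun a => (InnerProductSpace.rankOne ℂ (w a) (w a)).toLinearMap
  have hr : ∀ a, (r a).IsPositive := fun a =>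
    (ContinuousLinearMap.isPositive_toLinearMap_iff _).2
      (InnerProductSpace.isPositive_rankOne_self (w a))
  have hr1 : ∀ a x, (⟪x, r a x⟫_ℂ).re = ‖⟪w a, x⟫_ℂ‖ ^ 2 := fun a x => by
    have := sum_rankOne_inner (fun _ : Unit => w a) x
    simp only [Finset.univ_unique, Finset.sum_singleton] at this
    simp only [r, ContinuousLinearMap.coe_coe, InnerProductSpace.rankOne_apply, this,
      Complex.ofReal_re]
  -- The Bessel inequality says exactly that Q is positive. Assigning this remainder to one
  -- arbitrary outcome can only increase the probabilities.
  let Q : H →ₗ[ℂ] H := LinearMap.id - ∑ a, r a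
  have hQ : Q.IsPositive := by
    refine ⟨LinearMap.IsSymmetric.id.sub
      (LinearMap.isPositive_sum Finset.univ fun a _ => hr a).isSymmetric, fun x => ?_⟩
    have h2 : Q x = x - ∑ a, ⟪w a, x⟫_ℂ • w a := by simp [Q, r]
    rw [← inner_conj_symm, RCLike.conj_re, h2, inner_sub_right, sum_rankOne_inner,
      inner_self_eq_norm_sq_to_K]
    have := hw x
    simp only [map_sub, RCLike.re_to_complex, Complex.ofReal_re]
    have h3 : ((‖x‖ : ℂ) ^ 2).re = ‖x‖ ^ 2 := by norm_cast
    exact (sub_nonneg.2 this).trans_eq (by rw [← h3]; rfl)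
  obtain ⟨x₀⟩ := ‹Nonempty X›
  have hE : ∀ a, (if a = x₀ then Q else 0).IsPositive := fun a => by
    split_ifs
    · exact hQ
    · exact LinearMap.isPositive_zero
  refine ⟨fun a => r a + if a = x₀ then Q else 0, fun a => (hr a).add (hE a), ?_, fun a x => ?_⟩
  · simp [Finset.sum_add_distrib, Q]
  · rw [LinearMap.add_apply, inner_add_right, Complex.add_re, hr1]
    have := (hE a).re_inner_nonneg_right x
    simpa using this

variable {G : Type*} [Group G] [Fintype G]

/-- The canonical tight frame of an orbit: some orbit is a Bessel family whose total square norm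
is the dimension of the span of the given orbit. -/
theorem exists_bessel_orbit (σ : G →* (H ≃ₗᵢ[ℂ] H)) (v : H) :
    ∃ s : H, (Module.finrank ℂ (Submodule.span ℂ (Set.range fun a => σ a v)) : ℝ) ≤
        Fintype.card G * ‖s‖ ^ 2 ∧
      ∀ x, ∑ a, ‖⟪σ a s, x⟫_ℂ‖ ^ 2 ≤ ‖x‖ ^ 2 := by
  classical
  -- The frame operator of the orbit; the witness is s = F^{-1/2} v, with a pseudo-inverse on the
  -- kernel of F.
  let F : H →ₗ[ℂ] H := ∑ a, (InnerProductSpace.rankOne ℂ (σ a v) (σ a v)).toLinearMap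
  have hFapp : ∀ x, F x = ∑ a, ⟪σ a v, x⟫_ℂ • σ a v := fun x => by simp [F]
  have hF : F.IsSymmetric := (LinearMap.isPositive_sum Finset.univ fun a _ =>
    (ContinuousLinearMap.isPositive_toLinearMap_iff _).2
      (InnerProductSpace.isPositive_rankOne_self (σ a v))).isSymmetric
  have hFσ : ∀ a x, F (σ a x) = σ a (F x) := fun a x => by
    rw [hFapp, hFapp, map_sum, ← Equiv.sum_comp (Equiv.mulLeft a)]
    refine Finset.sum_congr rfl fun g _ => ?_
    have : σ (a * g) v = σ a (σ g v) := by rw [map_mul]; rfl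
    rw [Equiv.coe_mulLeft, this, LinearIsometryEquiv.inner_map_map, map_smul]
  let b := hF.eigenvectorBasis rfl
  let l := hF.eigenvalues rfl
  have hb : ∀ i, F (b i) = (l i : ℂ) • b i := hF.apply_eigenvectorBasis rfl
  have hl : ∀ i, l i = ∑ a, ‖⟪σ a v, b i⟫_ℂ‖ ^ 2 := fun i => by
    have h := sum_rankOne_inner (fun a => σ a v) (b i)
    rw [← hFapp, hb, inner_smul_right, b.inner_eq_one, mul_one] at h
    exact_mod_cast h
  have hl0 : ∀ i, 0 ≤ l i := fun i => by rw [hl]; positivity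
  -- Since 0⁻¹ = 0, the operator R below vanishes on the kernel of F, and R F R is the projection
  -- onto the range of F.
  let r : Fin (Module.finrank ℂ H) → ℝ := fun i => (√(l i))⁻¹
  have hr : ∀ i, r i ^ 2 * l i = if l i = 0 then 0 else 1 := fun i => by
    split_ifs with h
    · simp [h]
    · simp only [r]
      rw [inv_pow, Real.sq_sqrt (hl0 i), inv_mul_cancel₀ h]
  let R : H → H := fun x => ∑ i, ((r i : ℂ) * ⟪b i, x⟫_ℂ) • b i
  have hbR : ∀ i x, ⟪b i, R x⟫_ℂ = r i * ⟪b i, x⟫_ℂ := fun i x => by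
    simp [R, b.inner_eq_ite]
  have hsym : ∀ x y, ⟪R x, y⟫_ℂ = ⟪x, R y⟫_ℂ := fun x y => by
    rw [← b.sum_inner_mul_inner, ← b.sum_inner_mul_inner]
    refine Finset.sum_congr rfl fun i _ => ?_
    rw [← inner_conj_symm, hbR, hbR, map_mul, Complex.conj_ofReal, inner_conj_symm]
    ring
  have hRσ : ∀ a x, R (σ a x) = σ a (R x) := fun a x => by
    refine b.repr.injective (PiLp.ext fun i => ?_)
    rw [b.repr_apply_apply, b.repr_apply_apply, hbR]
    simp only [R, map_sum, map_smul]
    conv_lhs => rw [← b.sum_repr x]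
    rw [map_sum, inner_sum, inner_sum, Finset.mul_sum]
    refine Finset.sum_congr rfl fun j _ => ?_
    rw [map_smul, inner_smul_right, inner_smul_right, b.repr_apply_apply]
    -- As σ a commutes with F, its matrix entries between different eigenvalues vanish; hence it
    -- commutes with R, a function of F.
    have h : (l j : ℂ) * ⟪b i, σ a (b j)⟫_ℂ = l i * ⟪b i, σ a (b j)⟫_ℂ := by
      have := hF (b i) (σ a (b j))
      rw [hb, hFσ, hb, map_smul, inner_smul_left, inner_smul_right, Complex.conj_ofReal] at this
      exact this.symm
    rcases eq_or_ne (⟪b i, σ a (b j)⟫_ℂ) 0 with h0 | h0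
    · simp [h0]
    · have h1 : l j = l i := by exact_mod_cast mul_right_cancel₀ h0 h
      simp only [r, h1]
      ring
  have hsw : ∀ a x, ⟪σ a (R v), x⟫_ℂ = ⟪σ a v, R x⟫_ℂ := fun a x => by rw [← hRσ, hsym]
  refine ⟨R v, ?_, fun x => ?_⟩
  -- Both sides are the trace of R F R, that is, the number of nonzero eigenvalues of F.
  · have h1 : (Fintype.card G : ℝ) * ‖R v‖ ^ 2 = ∑ i, r i ^ 2 * l i := by
      calc (Fintype.card G : ℝ) * ‖R v‖ ^ 2 = ∑ a, ‖σ a (R v)‖ ^ 2 := by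
            simp
        _ = ∑ a, ∑ i, r i ^ 2 * ‖⟪σ a v, b i⟫_ℂ‖ ^ 2 := by
            refine Finset.sum_congr rfl fun a _ => ?_
            rw [← b.sum_sq_norm_inner_right]
            refine Finset.sum_congr rfl fun i _ => ?_
            rw [← hRσ, hbR, norm_mul, mul_pow, norm_inner_symm]
            simp
        _ = _ := by
            rw [Finset.sum_comm]
            refine Finset.sum_congr rfl fun i _ => ?_
            rw [hl, Finset.mul_sum]
    rw [h1]
    simp only [hr]
    let S := Finset.univ.filter fun i => l i ≠ 0
    have h2 : ∑ i, (if l i = 0 then (0 : ℝ) else 1) = S.card := by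
      rw [Finset.card_filter]
      push_cast
      exact Finset.sum_congr rfl fun i _ => by split_ifs <;> simp_all
    rw [h2]
    -- Eigenvectors with eigenvalue 0 are orthogonal to the whole orbit.
    have h3 : Submodule.span ℂ (Set.range fun a => σ a v) ≤
        Submodule.span ℂ (↑(S.image b) : Set H) := by
      refine Submodule.span_le.2 ?_
      rintro _ ⟨a, rfl⟩
      change σ a v ∈ _
      rw [← b.sum_repr (σ a v)]
      refine Submodule.sum_mem _ fun i _ => ?_
      by_cases h : l i = 0
      · have h4 := hl i
        rw [h] at h4
        have h5 := (Finset.sum_eq_zero_iff_of_nonneg (fun a _ => by positivity)).1 h4.symm a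
          (Finset.mem_univ a)
        have h6 : ⟪b i, σ a v⟫_ℂ = 0 := by
          rw [inner_eq_zero_symm]
          simpa using h5
        rw [b.repr_apply_apply, h6, zero_smul]
        exact Submodule.zero_mem _
      · refine Submodule.smul_mem _ _ (Submodule.subset_span ?_)
        exact Finset.mem_coe.2 (Finset.mem_image_of_mem _ (by simp [S, h]))
    have h7 := (Submodule.finrank_mono h3).trans (finrank_span_finset_le_card _)
    exact_mod_cast h7.trans Finset.card_image_le
  · have h := sum_rankOne_inner (fun a => σ a v) (R x)
    rw [← hFapp, ← b.sum_inner_mul_inner] at h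
    have h8 : ∀ i, ⟪R x, b i⟫_ℂ * ⟪b i, F (R x)⟫_ℂ =
        ((r i ^ 2 * l i * ‖⟪b i, x⟫_ℂ‖ ^ 2 : ℝ) : ℂ) := fun i => by
      rw [← hF, hb, inner_smul_left, hbR, ← inner_conj_symm, hbR, map_mul, Complex.conj_ofReal,
        Complex.conj_ofReal]
      have := Complex.conj_mul' ⟪b i, x⟫_ℂ
      push_cast
      rw [← this]
      ring
    simp only [h8] at h
    rw [← Complex.ofReal_sum] at h
    have h9 := Complex.ofReal_injective h
    simp only [hsw]
    rw [← h9, ← b.sum_sq_norm_inner_right x]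
    refine Finset.sum_le_sum fun i _ => ?_
    rw [hr]
    split_ifs
    · simp
    · simp

end Measurements

/-! ### Kronecker powers of matrices, complete and partial. -/

section KroneckerPowers

open Matrix

variable {ι : Type*} [Fintype ι] [DecidableEq ι]

/-- The matrix `M ⊗ ⋯ ⊗ M` with `t` factors. -/
def kroneckerPow (M : Matrix ι ι ℂ) (t : ℕ) : Matrix (Fin t → ι) (Fin t → ι) ℂ :=
  Matrix.of fun P Q => ∏ i, M (P i) (Q i)

omit [Fintype ι] [DecidableEq ι] in
theorem kroneckerPow_apply (M : Matrix ι ι ℂ) (t : ℕ) (P Q : Fin t → ι) :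
    kroneckerPow M t P Q = ∏ i, M (P i) (Q i) := rfl

omit [DecidableEq ι] in
theorem kroneckerPow_mul (M M' : Matrix ι ι ℂ) (t : ℕ) :
    kroneckerPow (M * M') t = kroneckerPow M t * kroneckerPow M' t := by
  ext P Q
  simp only [kroneckerPow_apply, Matrix.mul_apply, Finset.prod_univ_sum, Fintype.piFinset_univ,
    Finset.prod_mul_distrib]

omit [Fintype ι] in
theorem kroneckerPow_one (t : ℕ) : kroneckerPow (1 : Matrix ι ι ℂ) t = 1 := by
  ext P Q
  simp [kroneckerPow_apply, Matrix.one_apply, Fintype.prod_ite_zero, funext_iff]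

omit [Fintype ι] [DecidableEq ι] in
theorem kroneckerPow_star (M : Matrix ι ι ℂ) (t : ℕ) :
    star (kroneckerPow M t) = kroneckerPow (star M) t := by
  ext P Q
  simp [kroneckerPow_apply, Matrix.star_apply]

/-- The matrix `M ⊗ ⋯ ⊗ M ⊗ 1 ⊗ ⋯ ⊗ 1` in which the first `k` of `t` factors are `M`. -/
def partialKroneckerPow (M : Matrix ι ι ℂ) (t k : ℕ) : Matrix (Fin t → ι) (Fin t → ι) ℂ :=
  Matrix.of fun P Q => ∏ i : Fin t, (if (i : ℕ) < k then M else 1) (P i) (Q i)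

omit [Fintype ι] in
theorem partialKroneckerPow_zero (M : Matrix ι ι ℂ) (t : ℕ) : partialKroneckerPow M t 0 = 1 := by
  rw [← kroneckerPow_one]
  ext P Q
  simp [kroneckerPow_apply, partialKroneckerPow]

omit [Fintype ι] in
theorem partialKroneckerPow_self (M : Matrix ι ι ℂ) (t : ℕ) :
    partialKroneckerPow M t t = kroneckerPow M t := by
  ext P Q
  simp [kroneckerPow_apply, partialKroneckerPow]

/-- With factors counted from 0, factor i is still the identity after i queries, so letting M act on
it replaces that identity by M and leaves the other factors unchanged. -/
theorem partialKroneckerPow_succ (M : Matrix ι ι ℂ) {t : ℕ} (i : Fin t) (P Q : Fin t → ι) :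
    ∑ y, M (P i) y * partialKroneckerPow M t i (Function.update P i y) Q =
      partialKroneckerPow M t (i + 1) P Q := by
  simp only [partialKroneckerPow, Matrix.of_apply]
  have h : ∀ y, ∏ j : Fin t, (if (j : ℕ) < (i : ℕ) then M else 1) (Function.update P i y j) (Q j) =
      (1 : Matrix ι ι ℂ) y (Q i) *
        ∏ j ∈ ({i}ᶜ : Finset (Fin t)), (if (j : ℕ) < (i : ℕ) then M else 1) (P j) (Q j) := by
    intro y
    rw [Fintype.prod_eq_mul_prod_compl i]
    congr 1
    · rw [Function.update_self, if_neg (lt_irrefl _)]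
    · refine Finset.prod_congr rfl fun j hj => ?_
      rw [Function.update_of_ne (by simpa using hj)]
  rw [Fintype.prod_eq_mul_prod_compl i]
  simp only [h, ← mul_assoc, ← Finset.sum_mul]
  congr 1
  · rw [← Matrix.mul_apply, Matrix.mul_one]
    simp
  · refine Finset.prod_congr rfl fun j hj => ?_
    have hne : (j : ℕ) ≠ i := fun h => by simp [Fin.ext_iff, h] at hj
    have : (j : ℕ) < i + 1 ↔ (j : ℕ) < i := by omega
    simp only [this]

end KroneckerPowers

/-! ### Query circuits in coordinates. -/

section Coordinates

variable {V : Type*} [NormedAddCommGroup V] [InnerProductSpace ℂ V]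
variable {ι : Type*} [Fintype ι] [DecidableEq ι]

theorem toMatrix_piTensorProduct_map (b : Module.Basis ι ℂ V) (t : ℕ) (f : V →ₗ[ℂ] V) :
    LinearMap.toMatrix (Basis.piTensorProduct fun _ : Fin t => b)
      (Basis.piTensorProduct fun _ : Fin t => b) (PiTensorProduct.map fun _ => f) =
      kroneckerPow (LinearMap.toMatrix b b f) t := by
  ext P Q
  simp [LinearMap.toMatrix_apply, kroneckerPow_apply]

theorem tensorProduct_repr_rTensor {κ K : Type*} [Fintype κ] [NormedAddCommGroup K]
    [InnerProductSpace ℂ K] (b : OrthonormalBasis ι ℂ V) (c : OrthonormalBasis κ ℂ K)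
    (f : V →ₗ[ℂ] V) (φ : V ⊗[ℂ] K) (x : ι) (n : κ) :
    (b.tensorProduct c).repr (f.rTensor K φ) (x, n) =
      ∑ y, LinearMap.toMatrix b.toBasis b.toBasis f x y * (b.tensorProduct c).repr φ (y, n) := by
  induction φ using TensorProduct.induction_on with
  | zero => simp
  | add φ φ' h h' =>
    simp only [map_add, PiLp.add_apply, h, h', mul_add, Finset.sum_add_distrib]
  | tmul v k =>
    simp only [LinearMap.rTensor_tmul, OrthonormalBasis.tensorProduct_repr_tmul_apply]
    have h := congrFun (LinearMap.toMatrix_mulVec_repr b.toBasis b.toBasis f v) x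
    simp only [OrthonormalBasis.coe_toBasis_repr_apply] at h
    rw [← h, Matrix.mulVec, dotProduct, Finset.mul_sum]
    refine Finset.sum_congr rfl fun y _ => ?_
    rw [OrthonormalBasis.coe_toBasis_repr_apply]
    ring

/-- The final state of an algorithm is a linear function of the `t`-th tensor power of the
oracle. -/
theorem exists_foldl_eq_sum {K : Type*} [AddCommGroup K] [Module ℂ K] (b : Module.Basis ι ℂ V)
    (ψ : V ⊗[ℂ] K) (t : ℕ) :
    ∀ U : Fin t → (V ⊗[ℂ] K →ₗ[ℂ] V ⊗[ℂ] K), ∃ v : (Fin t → ι) → (Fin t → ι) → V ⊗[ℂ] K,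
      ∀ f : V →ₗ[ℂ] V, Fin.foldl t (fun φ i => U i (f.rTensor K φ)) ψ =
        ∑ P, ∑ Q, kroneckerPow (LinearMap.toMatrix b b f) t P Q • v P Q := by
  induction t with
  | zero => exact fun U => ⟨fun _ _ => ψ, fun f => by simp [kroneckerPow_apply]⟩
  | succ t ih =>
    intro U
    obtain ⟨v, hv⟩ := ih fun i => U i.castSucc
    let S : ι → ι → V ⊗[ℂ] K →ₗ[ℂ] V ⊗[ℂ] K := fun x y =>
      (Matrix.toLin b b (Matrix.single x y 1)).rTensor K
    have hS : ∀ (f : V →ₗ[ℂ] V) φ,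
        f.rTensor K φ = ∑ x, ∑ y, LinearMap.toMatrix b b f x y • S x y φ := fun f φ => by
      have h1 : f = ∑ x, ∑ y, LinearMap.toMatrix b b f x y •
          Matrix.toLin b b (Matrix.single x y 1) := by
        conv_lhs => rw [← Matrix.toLin_toMatrix b b f,
          Matrix.matrix_eq_sum_single (LinearMap.toMatrix b b f)]
        simp only [map_sum]
        refine Finset.sum_congr rfl fun x _ => Finset.sum_congr rfl fun y _ => ?_
        rw [← map_smul, Matrix.smul_single, smul_eq_mul, mul_one]
      conv_lhs => rw [h1]
      have h2 : ∀ g : V →ₗ[ℂ] V, LinearMap.rTensorHom K g = g.rTensor K := fun _ => rfl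
      rw [← h2, map_sum, LinearMap.sum_apply]
      refine Finset.sum_congr rfl fun x _ => ?_
      rw [map_sum, LinearMap.sum_apply]
      refine Finset.sum_congr rfl fun y _ => ?_
      rw [map_smul, LinearMap.smul_apply, h2]
    -- The last entries of P and Q select the matrix unit in the last query; the initial segments
    -- index the expansion of the previous state.
    refine ⟨fun P Q => U (Fin.last t) (S (P (Fin.last t)) (Q (Fin.last t))
      (v (Fin.init P) (Fin.init Q))), fun f => ?_⟩
    rw [Fin.foldl_succ_last, hv f, hS]
    rw [← (Fin.snocEquiv fun _ => ι).sum_comp, Fintype.sum_prod_type]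
    simp only [map_sum, map_smul, Finset.smul_sum]
    refine Finset.sum_congr rfl fun x _ => ?_
    rw [Finset.sum_comm]
    refine Finset.sum_congr rfl fun P _ => ?_
    rw [← (Fin.snocEquiv fun _ => ι).sum_comp, Fintype.sum_prod_type]
    refine Finset.sum_congr rfl fun y _ => Finset.sum_congr rfl fun Q _ => ?_
    simp [Fin.snocEquiv, kroneckerPow_apply, Fin.prod_univ_castSucc, smul_smul, mul_comm]

/-- Used to run a circuit whose intermediate states are known in closed form. -/
theorem foldl_eq_of_step {α : Type*} {t : ℕ} (f : α → Fin t → α) (φ : ℕ → α)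
    (h : ∀ i : Fin t, f (φ i) i = φ (i + 1)) : Fin.foldl t f (φ 0) = φ t := by
  induction t with
  | zero => simp
  | succ t ih =>
    rw [Fin.foldl_succ_last, ih _ fun i => h i.castSucc]
    exact h (Fin.last t)

end Coordinates

/-! ### The unitary representation on t tensor factors with an ancilla. -/

section UnitaryPowers

variable {G : Type*} [Group G] [Fintype G]
variable {V : Type*} [NormedAddCommGroup V] [InnerProductSpace ℂ V]
variable {ι : Type*} [Fintype ι] [DecidableEq ι]

/-- The matrix of the unitary `π g` in an orthonormal basis. -/
def oracleMatrix (π : G →* (V ≃ₗᵢ[ℂ] V)) (b : OrthonormalBasis ι ℂ V) (g : G) : Matrix ι ι ℂ :=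
  LinearMap.toMatrix b.toBasis b.toBasis (toRep π g)

omit [Fintype G] in
theorem oracleMatrix_mul (π : G →* (V ≃ₗᵢ[ℂ] V)) (b : OrthonormalBasis ι ℂ V) (g h : G) :
    oracleMatrix π b (g * h) = oracleMatrix π b g * oracleMatrix π b h := by
  rw [oracleMatrix, map_mul, LinearMap.toMatrix_mul]; rfl

omit [Fintype G] in
theorem oracleMatrix_one (π : G →* (V ≃ₗᵢ[ℂ] V)) (b : OrthonormalBasis ι ℂ V) :
    oracleMatrix π b 1 = 1 := by
  rw [oracleMatrix, map_one, LinearMap.toMatrix_one]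

omit [Fintype G] in
theorem oracleMatrix_star (π : G →* (V ≃ₗᵢ[ℂ] V)) (b : OrthonormalBasis ι ℂ V) (g : G) :
    star (oracleMatrix π b g) = oracleMatrix π b g⁻¹ := by
  ext i j
  have h : ∀ (a : G) i j, oracleMatrix π b a i j = ⟪b i, π a (b j)⟫_ℂ := fun a i j => by
    rw [oracleMatrix, LinearMap.toMatrix_apply, OrthonormalBasis.coe_toBasis_repr_apply,
      b.repr_apply_apply, OrthonormalBasis.coe_toBasis]
    rfl
  rw [Matrix.star_apply, h, h, ← LinearIsometryEquiv.inner_map_map (π g) (b i), ← starRingEnd_apply,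
    inner_conj_symm]
  congr 1
  rw [map_inv]
  exact ((π g).apply_symm_apply (b j)).symm

open Kronecker in
/-- The unitary representation `g ↦ π(g)^{⊗t} ⊗ 1` in coordinates. -/
def powRep (π : G →* (V ≃ₗᵢ[ℂ] V)) (b : OrthonormalBasis ι ℂ V) (t : ℕ) (κ : Type*) [Fintype κ]
    [DecidableEq κ] :
    G →* (EuclideanSpace ℂ ((Fin t → ι) × κ) ≃ₗᵢ[ℂ] EuclideanSpace ℂ ((Fin t → ι) × κ)) :=
  Unitary.linearIsometryEquiv.toMonoidHom.comp
    ((Unitary.map (R := Matrix ((Fin t → ι) × κ) ((Fin t → ι) × κ) ℂ)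
      (S := EuclideanSpace ℂ ((Fin t → ι) × κ) →L[ℂ] EuclideanSpace ℂ ((Fin t → ι) × κ))
      { toFun := Matrix.toEuclideanCLM (n := (Fin t → ι) × κ) (𝕜 := ℂ)
        map_one' := map_one _
        map_mul' := map_mul _
        map_star' := map_star _ }).toMonoidHom.comp
    { toFun := fun g => ⟨kroneckerPow (oracleMatrix π b g) t ⊗ₖ (1 : Matrix κ κ ℂ),
        Matrix.kronecker_mem_unitary (by
          rw [Unitary.mem_iff, kroneckerPow_star, ← kroneckerPow_mul, ← kroneckerPow_mul,
            oracleMatrix_star, ← oracleMatrix_mul, ← oracleMatrix_mul, inv_mul_cancel,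
            mul_inv_cancel, oracleMatrix_one, kroneckerPow_one]
          exact ⟨rfl, rfl⟩) (one_mem _)⟩
      map_one' := Subtype.ext (by
        simp [oracleMatrix_one, kroneckerPow_one])
      map_mul' := fun g h => Subtype.ext (by
        simp [oracleMatrix_mul, kroneckerPow_mul, ← Matrix.mul_kronecker_mul]) })

omit [Fintype G] in
theorem powRep_apply (π : G →* (V ≃ₗᵢ[ℂ] V)) (b : OrthonormalBasis ι ℂ V) (t : ℕ) {κ : Type*}
    [Fintype κ] [DecidableEq κ] (g : G) (s : EuclideanSpace ℂ ((Fin t → ι) × κ)) (P : Fin t → ι)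
    (k : κ) :
    powRep π b t κ g s (P, k) = ∑ Q, kroneckerPow (oracleMatrix π b g) t P Q * s (Q, k) := by
  change Matrix.mulVec (Matrix.kroneckerMap (· * ·) (kroneckerPow (oracleMatrix π b g) t)
    (1 : Matrix κ κ ℂ)) s.ofLp (P, k) = _
  simp [Matrix.mulVec, dotProduct, Fintype.sum_prod_type, Matrix.one_apply]

end UnitaryPowers

/-! ### The upper bound, the optimal algorithms and the exact query complexity. -/

section OptimalAlgorithms

variable {G : Type*} [Group G] [Fintype G]
variable {V : Type*} [NormedAddCommGroup V] [InnerProductSpace ℂ V] [FiniteDimensional ℂ V]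
variable {ι : Type*} [Fintype ι] [DecidableEq ι]

/-- The dimension of the algebra spanned by the operators `π(g)^{⊗t}`. -/
def tensorPowDim (π : G →* (V ≃ₗᵢ[ℂ] V)) (t : ℕ) : ℕ :=
  Module.finrank ℂ (Submodule.span ℂ (Set.range fun g => tensorPow (toRep π) t g))

theorem tensorPowDim_eq_sumSqDegrees (π : G →* (V ≃ₗᵢ[ℂ] V)) (t : ℕ) :
    (tensorPowDim π t : ℂ) = sumSqDegrees (tensorPow (toRep π) t) := by
  have : FiniteDimensional ℂ (⨂[ℂ] _ : Fin t, V) :=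
    (Basis.piTensorProduct fun _ : Fin t => Module.finBasis ℂ V).finiteDimensional_of_finite
  exact finrank_span_range_eq_sumSqDegrees _

omit [Fintype G] [FiniteDimensional ℂ V] in
theorem tensorPowDim_eq_kroneckerPow (π : G →* (V ≃ₗᵢ[ℂ] V)) (b : OrthonormalBasis ι ℂ V)
    (t : ℕ) :
    tensorPowDim π t = Module.finrank ℂ
      (Submodule.span ℂ (Set.range fun g => kroneckerPow (oracleMatrix π b g) t)) := by
  let B := Basis.piTensorProduct fun _ : Fin t => b.toBasis
  rw [tensorPowDim, ← LinearEquiv.finrank_map_eq (LinearMap.toMatrix B B), Submodule.map_span,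
    ← Set.range_comp]
  have : (LinearMap.toMatrix B B) ∘ (fun g => tensorPow (toRep π) t g) =
      fun g => kroneckerPow (oracleMatrix π b g) t :=
    funext fun g => toMatrix_piTensorProduct_map b.toBasis t (toRep π g)
  rw [← this]
  rfl

theorem finrank_span_finalState_le (π : G →* (V ≃ₗᵢ[ℂ] V)) {t : ℕ} (A : QueryAlgorithm V G t) :
    Module.finrank ℂ (Submodule.span ℂ (Set.range fun a => A.finalState (π a))) ≤
      tensorPowDim π t := by
  let b := stdOrthonormalBasis ℂ V
  obtain ⟨v, hv⟩ := exists_foldl_eq_sum b.toBasis A.ψ t fun i => (A.U i).toLinearEquiv.toLinearMap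
  -- The linear map, independent of a, that sends π(a)^{⊗t} to the final state.
  let Φ : Matrix _ _ ℂ →ₗ[ℂ] V ⊗[ℂ] EuclideanSpace ℂ (Fin A.N) :=
    ∑ P, ∑ Q, (Matrix.entryLinearMap ℂ ℂ P Q).smulRight (v P Q)
  have h : (fun a => A.finalState (π a)) = Φ ∘ fun g => kroneckerPow (oracleMatrix π b g) t := by
    funext a
    refine (hv (toRep π a)).trans ?_
    simp [Φ, oracleMatrix]
  rw [tensorPowDim_eq_kroneckerPow π b, h, Set.range_comp, ← Submodule.map_span]
  exact Submodule.finrank_map_le _ _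

omit [FiniteDimensional ℂ V] in
theorem norm_finalState {X : Type*} [Fintype X] {t : ℕ} (A : QueryAlgorithm V X t)
    (O : V ≃ₗᵢ[ℂ] V) : ‖A.finalState O‖ = 1 := by
  have : ∀ (n : ℕ) (U : Fin n → ((V ⊗[ℂ] EuclideanSpace ℂ (Fin A.N)) ≃ₗᵢ[ℂ]
      (V ⊗[ℂ] EuclideanSpace ℂ (Fin A.N)))),
      ‖Fin.foldl n (fun φ i => U i (O.toLinearEquiv.toLinearMap.rTensor
        (EuclideanSpace ℂ (Fin A.N)) φ)) A.ψ‖ = 1 := by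
    intro n
    induction n with
    | zero => intro U; simpa using A.norm_ψ
    | succ n ih =>
      intro U
      rw [Fin.foldl_succ_last, LinearIsometryEquiv.norm_map]
      exact ((O.rTensor _).norm_map _).trans (ih fun i => U i.castSucc)
  exact this t A.U

theorem successProb_le (π : G →* (V ≃ₗᵢ[ℂ] V)) {t : ℕ} (A : QueryAlgorithm V G t) :
    successProb π A ≤ tensorPowDim π t / Fintype.card G := by
  rw [successProb, div_eq_inv_mul]
  gcongr
  refine (sum_re_inner_le_finrank A.E A.E_pos A.E_sum (fun a => A.finalState (π a))
    fun a => norm_finalState A (π a)).trans ?_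
  exact_mod_cast finrank_span_finalState_le π A

-- The span contains the identity, which is nonzero because V is. This lets the frame vector of the
-- optimal algorithm be normalised.
omit [Fintype G] in
theorem tensorPowDim_pos [Nontrivial V] (π : G →* (V ≃ₗᵢ[ℂ] V)) (t : ℕ) :
    0 < tensorPowDim π t := by
  let b := stdOrthonormalBasis ℂ V
  have : Nonempty (Fin (Module.finrank ℂ V)) := b.toBasis.index_nonempty
  rw [tensorPowDim_eq_kroneckerPow π b, Module.finrank_pos_iff_exists_ne_zero]
  refine ⟨⟨_, Submodule.subset_span ⟨1, rfl⟩⟩, fun h => ?_⟩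
  have h1 := congrArg Subtype.val h
  simp only [oracleMatrix_one, kroneckerPow_one] at h1
  exact one_ne_zero h1

/-- Isolating the `i`-th tensor factor: coordinates of `V ⊗ ℂᴺ` as coordinates of `V^{⊗t} ⊗ ℂ^κ`. -/
def factorEquiv (ι κ : Type) [Fintype ι] [DecidableEq ι] [Fintype κ] {n : ℕ} (i : Fin (n + 1)) :
    ι × Fin (Fintype.card ((Fin n → ι) × κ)) ≃ (Fin (n + 1) → ι) × κ :=
  ((Equiv.refl ι).prodCongr (Fintype.equivFin ((Fin n → ι) × κ)).symm).trans
    ((Equiv.prodAssoc ι (Fin n → ι) κ).symm.trans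
      ((Fin.insertNthEquiv (fun _ => ι) i).prodCongr (Equiv.refl κ)))

/-- The unitary of `V ⊗ ℂᴺ` onto `V^{⊗t} ⊗ ℂ^κ` sending `V` to the `i`-th tensor factor. -/
def factorIsometry {ι κ : Type} [Fintype ι] [DecidableEq ι] [Fintype κ]
    (b : OrthonormalBasis ι ℂ V) {n : ℕ} (i : Fin (n + 1)) :
    (V ⊗[ℂ] EuclideanSpace ℂ (Fin (Fintype.card ((Fin n → ι) × κ)))) ≃ₗᵢ[ℂ]
      EuclideanSpace ℂ ((Fin (n + 1) → ι) × κ) :=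
  ((b.tensorProduct (EuclideanSpace.basisFun _ ℂ)).reindex (factorEquiv ι κ i)).repr

-- The workspace encodes the other n tensor factors together with the ancilla, so a query, which
-- always acts on V, acts on the i-th factor.
omit [FiniteDimensional ℂ V] in
theorem factorIsometry_rTensor {ι κ : Type} [Fintype ι] [DecidableEq ι] [Fintype κ]
    (b : OrthonormalBasis ι ℂ V) {n : ℕ} (i : Fin (n + 1)) (f : V →ₗ[ℂ] V)
    (φ : V ⊗[ℂ] EuclideanSpace ℂ (Fin (Fintype.card ((Fin n → ι) × κ))))
    (P : Fin (n + 1) → ι) (k : κ) :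
    factorIsometry b i (f.rTensor _ φ) (P, k) =
      ∑ y, LinearMap.toMatrix b.toBasis b.toBasis f (P i) y *
        factorIsometry b i φ (Function.update P i y, k) := by
  have h : ∀ y, (factorEquiv ι κ i).symm (Function.update P i y, k) =
      (y, Fintype.equivFin _ (i.removeNth P, k)) := fun y => by
    simp [factorEquiv]
  have h0 := h (P i)
  rw [Function.update_eq_self] at h0
  simp only [factorIsometry, OrthonormalBasis.repr_reindex, h, h0]
  exact tensorProduct_repr_rTensor b _ f φ _ _

-- For v the unnormalised maximally entangled vector, the coordinates of (M ⊗ 1) v are the entries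
-- of M, so the orbit of v carries all linear relations among the operators.
omit [Fintype G] [FiniteDimensional ℂ V] in
theorem tensorPowDim_le_powRep (π : G →* (V ≃ₗᵢ[ℂ] V)) {ι : Type} [Fintype ι] [DecidableEq ι]
    (b : OrthonormalBasis ι ℂ V) (t : ℕ) :
    ∃ v : EuclideanSpace ℂ ((Fin t → ι) × (Fin t → ι)), tensorPowDim π t ≤
      Module.finrank ℂ (Submodule.span ℂ (Set.range fun a => powRep π b t (Fin t → ι) a v)) := by
  let v : EuclideanSpace ℂ ((Fin t → ι) × (Fin t → ι)) :=
    WithLp.toLp 2 fun x => if x.1 = x.2 then 1 else 0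
  let c : EuclideanSpace ℂ ((Fin t → ι) × (Fin t → ι)) →ₗ[ℂ]
      Matrix (Fin t → ι) (Fin t → ι) ℂ :=
    { toFun := fun x => Matrix.of fun P Q => x (P, Q)
      map_add' := fun _ _ => rfl
      map_smul' := fun _ _ => rfl }
  refine ⟨v, ?_⟩
  have h : (fun a => kroneckerPow (oracleMatrix π b a) t) =
      c ∘ fun a => powRep π b t (Fin t → ι) a v := by
    funext a
    ext P Q
    change _ = powRep π b t (Fin t → ι) a v (P, Q)
    simp [powRep_apply, v]
  rw [tensorPowDim_eq_kroneckerPow π b, h, Set.range_comp, ← Submodule.map_span]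
  exact Submodule.finrank_map_le _ _

/-- The state after `k` sequential queries, the `i`-th one applied to the `i`-th tensor factor. -/
def partialState {ι κ : Type} [Fintype ι] [DecidableEq ι] [Fintype κ] (M : Matrix ι ι ℂ) (t k : ℕ)
    (s : EuclideanSpace ℂ ((Fin t → ι) × κ)) : EuclideanSpace ℂ ((Fin t → ι) × κ) :=
  WithLp.toLp 2 fun x => ∑ Q, partialKroneckerPow M t k x.1 Q * s (Q, x.2)

omit [Fintype G] [FiniteDimensional ℂ V] in
/-- Sequential queries interleaved with permutations of the tensor factors implement
`π(g)^{⊗t} ⊗ 1`. -/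
theorem finalState_eq_powRep (π : G →* (V ≃ₗᵢ[ℂ] V)) {ι κ : Type} [Fintype ι] [DecidableEq ι]
    [Fintype κ] [DecidableEq κ] (b : OrthonormalBasis ι ℂ V) (n : ℕ)
    (s : EuclideanSpace ℂ ((Fin (n + 1) → ι) × κ)) (a : G) :
    Fin.foldl (n + 1) (fun φ (i : Fin (n + 1)) =>
      ((factorIsometry b i).trans (factorIsometry b (Fin.ofNat (n + 1) (i + 1))).symm)
        ((π a).toLinearEquiv.toLinearMap.rTensor _ φ)) ((factorIsometry b (κ := κ) 0).symm s) =
      (factorIsometry b 0).symm (powRep π b (n + 1) κ a s) := by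
  -- Before query k the register V holds factor k, and factors 0, …, k-1 have been acted on. The
  -- unitary after query i moves V from factor i to factor i + 1.
  have h := foldl_eq_of_step (fun φ (i : Fin (n + 1)) =>
      ((factorIsometry b i).trans (factorIsometry b (Fin.ofNat (n + 1) (i + 1))).symm)
        ((π a).toLinearEquiv.toLinearMap.rTensor _ φ))
    (fun k => (factorIsometry b (κ := κ) (Fin.ofNat (n + 1) k)).symm
      (partialState (oracleMatrix π b a) (n + 1) k s)) fun i => by
    have hi : Fin.ofNat (n + 1) (i : ℕ) = i := Fin.ofNat_val_eq_self i
    simp only [LinearIsometryEquiv.trans_apply, hi]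
    congr 1
    ext ⟨P, k⟩
    rw [factorIsometry_rTensor]
    simp only [LinearIsometryEquiv.apply_symm_apply, partialState, Finset.mul_sum]
    rw [Finset.sum_comm]
    refine Finset.sum_congr rfl fun Q _ => ?_
    rw [← partialKroneckerPow_succ, Finset.sum_mul]
    refine Finset.sum_congr rfl fun y _ => ?_
    rw [← mul_assoc]
    rfl
  have h0 : partialState (oracleMatrix π b a) (n + 1) 0 s = s := by
    ext ⟨P, k⟩
    simp [partialState, partialKroneckerPow_zero, Matrix.one_apply]
  have h1 : partialState (oracleMatrix π b a) (n + 1) (n + 1) s = powRep π b (n + 1) κ a s := by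
    ext ⟨P, k⟩
    rw [powRep_apply, partialState, partialKroneckerPow_self]
  -- The index wraps around, so the last unitary returns V to factor 0.
  have h2 : Fin.ofNat (n + 1) (n + 1) = 0 := by ext; simp [Fin.ofNat]
  have h3 : Fin.ofNat (n + 1) 0 = 0 := rfl
  rw [h0, h1, h2, h3] at h
  exact h

theorem norm_inner_inv_smul_self {H : Type*} [NormedAddCommGroup H] [InnerProductSpace ℂ H] {r : ℝ}
    (w : H) (hw : ‖w‖ = r) (hr : r ≠ 0) : ‖⟪w, ((r⁻¹ : ℝ) : ℂ) • w⟫_ℂ‖ = r := by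
  rw [inner_smul_right, inner_self_eq_norm_sq_to_K, hw]
  have : 0 ≤ r := hw ▸ norm_nonneg w
  simp [pow_two, hr, abs_of_nonneg this]

/-- An algorithm with success probability `|G|⁻¹ dim span {π(g)^{⊗t}}`, for positive `t`. -/
theorem exists_algorithm_succ [Nontrivial V] (π : G →* (V ≃ₗᵢ[ℂ] V)) (n : ℕ) :
    ∃ A : QueryAlgorithm V G (n + 1),
      (tensorPowDim π (n + 1) / Fintype.card G : ℝ) ≤ successProb π A := by
  let b := stdOrthonormalBasis ℂ V
  obtain ⟨v, hv⟩ := tensorPowDim_le_powRep π b (n + 1)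
  obtain ⟨s, hs, hbessel⟩ := exists_bessel_orbit (powRep π b (n + 1) _) v
  have hG : (0 : ℝ) < Fintype.card G := by exact_mod_cast Fintype.card_pos
  have hD : (tensorPowDim π (n + 1) : ℝ) ≤ Fintype.card G * ‖s‖ ^ 2 :=
    le_trans (by exact_mod_cast hv) hs
  have hs0 : ‖s‖ ≠ 0 := by
    intro h
    have h1 : (0 : ℝ) < tensorPowDim π (n + 1) := by exact_mod_cast tensorPowDim_pos π (n + 1)
    rw [h] at hD
    linarith
  let J := factorIsometry (κ := Fin (n + 1) → Fin (Module.finrank ℂ V)) b (0 : Fin (n + 1))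
  let w : G → V ⊗[ℂ] EuclideanSpace ℂ (Fin _) := fun a => J.symm (powRep π b (n + 1) _ a s)
  obtain ⟨E, hE, hE1, hE2⟩ := exists_povm w fun x => by
    refine (le_of_eq ?_).trans ((hbessel (J x)).trans_eq (by rw [J.norm_map]))
    refine Finset.sum_congr rfl fun a _ => ?_
    rw [← J.inner_map_map (w a), J.apply_symm_apply]
  let A : QueryAlgorithm V G (n + 1) :=
    { N := _
      ψ := J.symm (((‖s‖⁻¹ : ℝ) : ℂ) • s)
      norm_ψ := by
        rw [LinearIsometryEquiv.norm_map, norm_smul, Complex.norm_real, norm_inv, norm_norm,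
          inv_mul_cancel₀ hs0]
      U := fun i => (factorIsometry b i).trans (factorIsometry b (Fin.ofNat (n + 1) (i + 1))).symm
      E := E
      E_pos := hE
      E_sum := hE1 }
  have hfinal : ∀ a, A.finalState (π a) = ((‖s‖⁻¹ : ℝ) : ℂ) • w a := fun a => by
    refine (finalState_eq_powRep π b n (((‖s‖⁻¹ : ℝ) : ℂ) • s) a).trans ?_
    rw [map_smul, map_smul]
  have hnorm : ∀ a, ‖w a‖ = ‖s‖ := fun a => by
    rw [LinearIsometryEquiv.norm_map, LinearIsometryEquiv.norm_map]
  -- The final state is w a / ‖s‖ with ‖w a‖ = ‖s‖, so the rank-one part of E a alone contributes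
  -- ‖s‖².
  have hprob : ∀ a, ‖s‖ ^ 2 ≤ A.outputProb (π a) a := fun a => by
    have h1 : ∀ x, x = ((‖s‖⁻¹ : ℝ) : ℂ) • w a → ‖s‖ ^ 2 ≤ (⟪x, E a x⟫_ℂ).re := by
      intro x hx
      have h2 : ‖⟪w a, x⟫_ℂ‖ = ‖s‖ := by
        rw [hx]
        exact norm_inner_inv_smul_self (w a) (hnorm a) hs0
      simpa only [h2] using hE2 a x
    exact h1 _ (hfinal a)
  refine ⟨A, ?_⟩
  rw [successProb, div_eq_inv_mul]
  gcongr
  refine hD.trans ?_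
  calc (Fintype.card G : ℝ) * ‖s‖ ^ 2 = ∑ _a : G, ‖s‖ ^ 2 := by simp
    _ ≤ _ := Finset.sum_le_sum fun a _ => hprob a

/-- With t = 0 there is no tensor factor to identify with V, so the general construction does not
apply. Here the span has dimension at most 1, and always guessing the identity succeeds with
probability 1/|G|. -/
theorem exists_algorithm_zero [Nontrivial V] (π : G →* (V ≃ₗᵢ[ℂ] V)) :
    ∃ A : QueryAlgorithm V G 0, (tensorPowDim π 0 / Fintype.card G : ℝ) ≤ successProb π A := by
  classical
  obtain ⟨v, hv⟩ := exists_norm_eq V zero_le_one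
  let A : QueryAlgorithm V G 0 :=
    { N := 1
      ψ := v ⊗ₜ EuclideanSpace.single 0 1
      norm_ψ := by simp [hv]
      U := Fin.elim0
      E := fun a => if a = 1 then LinearMap.id else 0
      E_pos := fun a => by
        split_ifs
        · exact LinearMap.isPositive_id
        · exact LinearMap.isPositive_zero
      E_sum := by simp }
  refine ⟨A, ?_⟩
  have h1 : tensorPowDim π 0 ≤ 1 := by
    rw [tensorPowDim_eq_kroneckerPow π (stdOrthonormalBasis ℂ V)]
    refine (Submodule.finrank_le _).trans ?_
    rw [Module.finrank_matrix]
    simp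
  have h2 : A.outputProb (π 1) 1 = 1 := by
    have h : ∀ ψ : V ⊗[ℂ] EuclideanSpace ℂ (Fin 1), ‖ψ‖ = 1 → (⟪ψ, ψ⟫_ℂ).re = 1 :=
      fun ψ hψ => by
        have := inner_self_eq_norm_sq (𝕜 := ℂ) ψ
        rw [hψ, one_pow] at this
        exact this
    have hE : A.E 1 = LinearMap.id := if_pos rfl
    rw [QueryAlgorithm.outputProb, hE]
    exact h _ (norm_finalState A (π 1))
  have h3 : ∀ a, 0 ≤ A.outputProb (π a) a := fun a => (A.E_pos a).re_inner_nonneg_right _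
  rw [successProb, div_eq_inv_mul]
  gcongr
  calc (tensorPowDim π 0 : ℝ) ≤ 1 := by exact_mod_cast h1
    _ = A.outputProb (π 1) 1 := h2.symm
    _ ≤ _ := Finset.single_le_sum (fun a _ => h3 a) (Finset.mem_univ 1)

/-- The optimal success probability of a `t`-query algorithm. -/
theorem isGreatest_successProb [Nontrivial V] (π : G →* (V ≃ₗᵢ[ℂ] V)) (t : ℕ) :
    IsGreatest (Set.range fun A : QueryAlgorithm V G t => successProb π A)
      (tensorPowDim π t / Fintype.card G) := by
  constructor
  · have h : ∃ A : QueryAlgorithm V G t,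
        (tensorPowDim π t / Fintype.card G : ℝ) ≤ successProb π A := by
      cases t with
      | zero => exact exists_algorithm_zero π
      | succ n => exact exists_algorithm_succ π n
    obtain ⟨A, hA⟩ := h
    exact ⟨A, (successProb_le π A).antisymm hA⟩
  · rintro _ ⟨A, rfl⟩
    exact successProb_le π A

/-- The span of |G| operators has dimension at most |G|, so the optimum is 1 iff this dimension
equals |G|, iff the squared degrees of the appearing characters already exhaust |G|. -/
theorem exists_successProb_eq_one_iff [Nontrivial V] (π : G →* (V ≃ₗᵢ[ℂ] V)) (t : ℕ) :
    (∃ A : QueryAlgorithm V G t, successProb π A = 1) ↔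
      irrChars G ⊆ appearing (tensorPow (toRep π) t) := by
  have hG : (0 : ℝ) < Fintype.card G := by exact_mod_cast Fintype.card_pos
  have hle : tensorPowDim π t ≤ Fintype.card G := finrank_range_le_card _
  have hopt := isGreatest_successProb π t
  rw [← sumSqDegrees_eq_card_iff, ← tensorPowDim_eq_sumSqDegrees, Nat.cast_inj]
  constructor
  · rintro ⟨A, hA⟩
    have h := hopt.2 ⟨A, rfl⟩
    simp only [hA] at h
    rw [one_le_div hG] at h
    exact hle.antisymm (by exact_mod_cast h)
  · intro h
    obtain ⟨A, hA⟩ := hopt.1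
    refine ⟨A, hA.trans ?_⟩
    rw [h, div_self hG.ne']

end OptimalAlgorithms

end SymmetricOracle

end

theorem theorem4p2 {G : Type*} [Group G] [Fintype G]
    {V : Type*} [NormedAddCommGroup V] [InnerProductSpace ℂ V] [FiniteDimensional ℂ V]
    [Nontrivial V] (π : G →* (V ≃ₗᵢ[ℂ] V)) :
    (∀ t : ℕ, ∃ Popt : ℝ,
      IsGreatest (Set.range fun A : SymmetricOracle.QueryAlgorithm V G t =>
        SymmetricOracle.successProb π A) Popt ∧
      (Popt : ℂ) = SymmetricOracle.sumSqDegrees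
        (SymmetricOracle.tensorPow (SymmetricOracle.toRep π) t) / (Fintype.card G : ℂ)) ∧
    SymmetricOracle.exactQueryComplexity π =
      SymmetricOracle.quantumBaseSize (SymmetricOracle.toRep π) := by
  refine ⟨fun t => ⟨_, SymmetricOracle.isGreatest_successProb π t, ?_⟩, ?_⟩
  · rw [← SymmetricOracle.tensorPowDim_eq_sumSqDegrees]
    push_cast
    rfl
  -- The two infima range over the same set of t.
  · simp only [SymmetricOracle.exactQueryComplexity, SymmetricOracle.quantumBaseSize,
      SymmetricOracle.exists_successProb_eq_one_iff]
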